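/- For a real number $q>0$ let $\mathcal G(q)=\{0,\,1,\,1+q,\,1+q+q^2,\,\dots\}\subset\mathbb R$ with the standard metric, and let $\mathbb R^n_\infty$ be $\mathbb R^n$ with the maximum metric $\|x-y\|_\infty=\max_i|x_i-y_i|$. A subset $C$ of a metric space is a copy of a metric space $\mathcal M$ if there is a bijective isometry $\mathcal M\to C$. A copy $C\subset\mathbb R^n_\infty$ of $\mathcal G(q)$ is called proper if for some $i\in\{1,\dots,n\}$ the set of $i$-th coordinates of the points of $C$ is a translate of $-\mathcal G(q)$. Let $\chi(\mathbb R^n_\infty,\mathcal M)$ denote the smallest $k$ such that $\mathbb R^n$ can be coloured with $k$ colours without a monochromatic copy of $\mathcal M$. (i) Let $n$ be a positive integer, $0<\varepsilon\le\frac12$ and $0<q\le\varepsilon/2^{n+1}$. Then every colouring of the cube $[-\varepsilon,1+\varepsilon]^n$ with $n$ colours contains a monochromatic proper copy of $\mathcal G(q)$ (with respect to the maximum metric). (ii) For every positive integer $n$ there exists $q_0>0$ such that $\chi(\mathbb R^n_\infty,\mathcal G(q))=n+1$ for all $0<q\le q_0$. -/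

import Mathlib

/-- The geometric progression `{0, 1, 1 + q, 1 + q + q², …} ⊆ ℝ` of partial sums; as a subtype of
`ℝ` it carries the standard metric. -/
def geomBaton (q : ℝ) : Set ℝ :=
  Set.range fun k : ℕ => ∑ i ∈ Finset.range k, q ^ i

/-- `C ⊆ X` is a copy of the metric space `Y`: there is a bijective isometry from `Y` onto `C`. -/
def IsCopy (Y : Type*) [MetricSpace Y] {X : Type*} [MetricSpace X] (C : Set X) : Prop :=
  Nonempty (Y ≃ᵢ C)

/-- All points of `C` have the same colour. -/
def IsMonochromatic {X κ : Type*} (c : X → κ) (C : Set X) : Prop :=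
  ∀ x ∈ C, ∀ y ∈ C, c x = c y

/-- `X` can be coloured with `k` colours without a monochromatic copy of `Y`. -/
def ColorableAvoiding (X : Type*) [MetricSpace X] (Y : Type*) [MetricSpace Y] (k : ℕ) : Prop :=
  ∃ c : X → Fin k, ∀ C : Set X, IsCopy Y C → ¬ IsMonochromatic c C

/-- The chromatic number `χ(X, Y)`: the smallest `k` such that `X` can be coloured with `k` colours
without a monochromatic copy of `Y` (and `⊤` if no finite number of colours suffices). -/
noncomputable def chromaticNumberAvoiding (X : Type*) [MetricSpace X]
    (Y : Type*) [MetricSpace Y] : ℕ∞ :=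
  ⨅ (k : ℕ) (_ : ColorableAvoiding X Y k), (k : ℕ∞)

/-- `C ⊆ ℝⁿ` is a proper isometric copy of `geomBaton q` in the maximum metric (the metric of
`Fin n → ℝ`): it is an isometric copy and, for some `i`, the set of the `i`-th coordinates of its
points is a translate of `-geomBaton q`. -/
def IsProperCopy {n : ℕ} (q : ℝ) (C : Set (Fin n → ℝ)) : Prop :=
  IsCopy (geomBaton q) C ∧
    ∃ i : Fin n, ∃ t : ℝ, (fun x : Fin n → ℝ => x i) '' C = (fun g : ℝ => t - g) '' geomBaton q

/-- The cube `[-ε, 1 + ε]ⁿ`. -/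
def cube (n : ℕ) (ε : ℝ) : Set (Fin n → ℝ) :=
  {x | ∀ i, x i ∈ Set.Icc (-ε) (1 + ε)}

/-!
For (i), consider a box together with a colouring in which only the colours from a set `S` of
directions occur, and a sequence of colour `i` whose `i`-th coordinates drop by `r`, `r * q`,
`r * q ^ 2`, … while the other coordinates move no faster: a descent of scale `r`. A descent of
scale `1` is a proper copy. If a face orthogonal to direction `i` has no point of colour `i`,
induction on `S` gives a descent inside this face. Start from a point `p` of colour `i` and choose
the steps of a descent one by one in faces around the current point. If this gets stuck, there is
a descent of a different colour and of a tiny scale `r * q ^ (k + 1)` close to `p`. A descent of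
colour `j` and scale `ρ * q` can always be traded for one of scale `ρ`: the face at height `ρ` above
its first point in direction `j` either has a point of colour `j`, which can be put in front, or
contains a descent of scale `ρ`. Repeating this recovers the scale `r`.

For the upper bound in (ii), choose `β` such that `β * q ^ k` lies in `[1 / 4, 1 / 2]` modulo
`n + 1` for all small `k`; then `⌊β * (t ± g)⌋` runs through all residues modulo `n + 1` as `g` runs
through the progression. Colour `x` by a residue that is missed by all `⌊β * x i⌋`. A copy of the
progression is parallel to it in some coordinate up to any finite stage, so the residues along this
coordinate include the colour of the copy, which the colouring forbids.
-/

open Finset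

theorem exists_seq_of_forall_exists_succ {α : Type*} {P : ℕ → α → Prop} {R : ℕ → α → α → Prop}
    {x₀ : α} (h₀ : P 0 x₀) (h : ∀ k x, P k x → ∃ y, P (k + 1) y ∧ R k x y) :
    ∃ x : ℕ → α, x 0 = x₀ ∧ ∀ k, P k (x k) ∧ R k (x k) (x (k + 1)) := by
  choose! f hf using h
  let x : ℕ → α := fun k => Nat.rec x₀ f k
  have hP : ∀ k, P k (x k) := fun k => Nat.rec h₀ (fun k hk => (hf k _ hk).1) k
  exact ⟨x, rfl, fun k => ⟨hP k, (hf k _ (hP k)).2⟩⟩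

section Descent

variable {ι : Type*} {c : (ι → ℝ) → ι} {B : Set (ι → ℝ)} {S : Finset ι} {i : ι}
  {a b p x : ι → ℝ} {ε η q r s ρ t : ℝ}

/-- The points of the box `[a, b]` at distance at least `η` from its faces orthogonal to the
directions in `S`. The box may be degenerate in the other directions. -/
def deepBox (S : Finset ι) (a b : ι → ℝ) (η : ℝ) : Set (ι → ℝ) :=
  {x ∈ Set.Icc a b | ∀ l ∈ S, x l ∈ Set.Icc (a l + η) (b l - η)}

theorem room_of_mem_deepBox (hε : ε ≤ 1) (hρ : 0 ≤ ρ) (hx : x ∈ deepBox S a b ρ) :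
    ∀ l ∈ S, (1 + ε) * ρ ≤ min (b l) (x l + ρ) - max (a l) (x l - ρ) := by
  intro l hl
  obtain ⟨hal, hbl⟩ := hx.2 l hl
  rw [min_eq_right (by linarith), max_eq_right (by linarith)]
  nlinarith

variable [Fintype ι]

/-- A descent of scale `r` and ratio `q` in `B`: a sequence in `B` of points of colour `i` whose
`i`-th coordinates drop by `r`, `r * q`, `r * q ^ 2`, … while the other coordinates move by at most
as much. The colours are the coordinate directions. -/
structure IsDescent (c : (ι → ℝ) → ι) (B : Set (ι → ℝ)) (i : ι) (r q : ℝ) (x : ℕ → ι → ℝ) :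
    Prop where
  mem (k : ℕ) : x k ∈ B
  color_eq (k : ℕ) : c (x k) = i
  apply_succ (k : ℕ) : x (k + 1) i = x k i - r * q ^ k
  dist_succ_le (k : ℕ) : dist (x k) (x (k + 1)) ≤ r * q ^ k

/-- Every box that has side at least `(1 + δ) * r` in the directions of `S` and carries only colours
of `S` contains a descent of scale `r`. This is the statement proved by induction on `S`. -/
def HasDescents (c : (ι → ℝ) → ι) (q δ : ℝ) (S : Finset ι) : Prop :=
  ∀ ⦃a b : ι → ℝ⦄ ⦃r : ℝ⦄, 0 < r → a ≤ b → (∀ l ∈ S, (1 + δ) * r ≤ b l - a l) →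
    Set.MapsTo c (Set.Icc a b) S → ∃ i ∈ S, ∃ x, IsDescent c (Set.Icc a b) i r q x

theorem IsDescent.mono {B' : Set (ι → ℝ)} {x : ℕ → ι → ℝ} (hx : IsDescent c B i r q x)
    (hB : B ⊆ B') : IsDescent c B' i r q x :=
  { hx with mem := fun k => hB (hx.mem k) }

theorem IsDescent.cons {x : ℕ → ι → ℝ} {y : ι → ℝ} (hx : IsDescent c B i (r * q) q x) (hy : y ∈ B)
    (hcy : c y = i) (hyi : y i = x 0 i + r) (hyx : dist y (x 0) ≤ r) :
    IsDescent c B i r q (fun k => Nat.casesOn k y x) where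
  mem | 0 => hy | k + 1 => hx.mem k
  color_eq | 0 => hcy | k + 1 => hx.color_eq k
  apply_succ
    | 0 => by simp [hyi]
    | k + 1 => by simpa only [pow_succ', mul_assoc] using hx.apply_succ k
  dist_succ_le
    | 0 => by simpa using hyx
    | k + 1 => by simpa only [pow_succ', mul_assoc] using hx.dist_succ_le k

theorem mem_deepBox_of_dist_le (hp : p ∈ deepBox S a b η) (hx : x ∈ Set.Icc a b)
    (hxp : dist x p ≤ η - ρ) : x ∈ deepBox S a b ρ := by
  refine ⟨hx, fun l hl => ?_⟩
  have hxl := abs_le.1 ((dist_le_pi_dist x p l).trans hxp)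
  have hpl := hp.2 l hl
  constructor <;> linarith [hxl.1, hxl.2, hpl.1, hpl.2]

variable [DecidableEq ι]

/-- `hroom` bounds the sides of the face `{y ∈ [a, b] | dist y x ≤ ρ, y i = t}` from below. -/
theorem exists_color_eq_or_exists_isDescent (hS : HasDescents c q ε (S.erase i))
    (hc : Set.MapsTo c (Set.Icc a b) S) (hρ : 0 < ρ) (hx : x ∈ Set.Icc a b)
    (ht : t ∈ Set.Icc (a i) (b i)) (htx : |t - x i| ≤ ρ)
    (hroom : ∀ l ∈ S.erase i, (1 + ε) * ρ ≤ min (b l) (x l + ρ) - max (a l) (x l - ρ)) :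
    (∃ y ∈ Set.Icc a b, dist y x ≤ ρ ∧ y i = t ∧ c y = i) ∨
      ∃ j ∈ S.erase i, ∃ z, IsDescent c (Set.Icc a b) j ρ q z ∧ dist (z 0) x ≤ ρ := by
  set a' := Function.update (fun l => max (a l) (x l - ρ)) i t
  set b' := Function.update (fun l => min (b l) (x l + ρ)) i t
  have hface : ∀ y ∈ Set.Icc a' b', y ∈ Set.Icc a b ∧ dist y x ≤ ρ ∧ y i = t := by
    rintro y ⟨hay, hyb⟩
    obtain ⟨hty, hay⟩ := update_le_iff.1 hay
    obtain ⟨hyt, hyb⟩ := le_update_iff.1 hyb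
    have hyi : y i = t := le_antisymm hyt hty
    have hy : ∀ l, (a l ≤ y l ∧ y l ≤ b l) ∧ |y l - x l| ≤ ρ := by
      intro l
      obtain rfl | hl := eq_or_ne l i
      · exact ⟨hyi ▸ ht, hyi ▸ htx⟩
      · obtain ⟨hal, hxl⟩ := max_le_iff.1 (hay l hl)
        obtain ⟨hbl, hlx⟩ := le_min_iff.1 (hyb l hl)
        exact ⟨⟨hal, hbl⟩, abs_le.2 ⟨by linarith, by linarith⟩⟩
    exact ⟨⟨fun l => (hy l).1.1, fun l => (hy l).1.2⟩,
      (dist_pi_le_iff hρ.le).2 fun l => (hy l).2, hyi⟩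
  by_cases hi : ∃ y ∈ Set.Icc a' b', c y = i
  · obtain ⟨y, hy, hcy⟩ := hi
    obtain ⟨hyB, hyx, hyi⟩ := hface y hy
    exact .inl ⟨y, hyB, hyx, hyi, hcy⟩
  · push Not at hi
    have hab' : a' ≤ b' := update_le_update_iff.2 ⟨le_rfl, fun l _ =>
      max_le (le_min (hx.1.trans hx.2 l) (by linarith [hx.1 l]))
        (le_min (by linarith [hx.2 l]) (by linarith))⟩
    have hside : ∀ l ∈ S.erase i, (1 + ε) * ρ ≤ b' l - a' l := fun l hl => by
      simpa only [a', b', Function.update_of_ne (ne_of_mem_erase hl)] using hroom l hl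
    obtain ⟨j, hj, z, hz⟩ := hS hρ hab' hside fun y hy =>
      mem_erase.2 ⟨hi y hy, hc (hface y hy).1⟩
    exact .inr ⟨j, hj, z, hz.mono fun y hy => (hface y hy).1, (hface _ (hz.mem 0)).2.1⟩

theorem IsDescent.exists_enlarge {x : ℕ → ι → ℝ} (hx : IsDescent c (Set.Icc a b) i (ρ * q) q x)
    (hi : i ∈ S) (hS : HasDescents c q ε (S.erase i)) (hc : Set.MapsTo c (Set.Icc a b) S)
    (hρ : 0 < ρ) (hxi : x 0 i + ρ ≤ b i)
    (hroom : ∀ l ∈ S.erase i, (1 + ε) * ρ ≤ min (b l) (x 0 l + ρ) - max (a l) (x 0 l - ρ)) :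
    ∃ j ∈ S, ∃ z, IsDescent c (Set.Icc a b) j ρ q z ∧ dist (z 0) (x 0) ≤ ρ := by
  have hai : a i ≤ x 0 i := (hx.mem 0).1 i
  rcases exists_color_eq_or_exists_isDescent (t := x 0 i + ρ) hS hc hρ (hx.mem 0)
    ⟨by linarith, hxi⟩ (by simp [abs_of_pos hρ]) hroom with ⟨y, hy, hyx, hyi, hcy⟩ | ⟨j, hj, hz⟩
  · exact ⟨i, hi, _, hx.cons hy hcy hyi hyx, hyx⟩
  · exact ⟨j, mem_of_mem_erase hj, hz⟩

theorem IsDescent.exists_of_scale_mul_pow (hS : ∀ i ∈ S, HasDescents c q ε (S.erase i))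
    (hc : Set.MapsTo c (Set.Icc a b) S) (hε : ε ≤ 1) (hq : 0 < q) (hq2 : q ≤ 1 / 2) (hs : 0 < s)
    (hsη : 4 * s ≤ η) (hp : p ∈ deepBox S a b η) (hi : i ∈ S) {k : ℕ} {x : ℕ → ι → ℝ}
    (hx : IsDescent c (Set.Icc a b) i (s * q ^ k) q x)
    (hxp : dist (x 0) p ≤ 2 * s + 2 * (s * q ^ k)) :
    ∃ j ∈ S, ∃ z, IsDescent c (Set.Icc a b) j s q z ∧ dist (z 0) p ≤ η := by
  induction k generalizing i x with
  | zero =>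
    rw [pow_zero, mul_one] at hx hxp
    exact ⟨i, hi, x, hx, by linarith⟩
  | succ k ih =>
    set ρ := s * q ^ k
    have hρ : 0 < ρ := by positivity
    have hρs : ρ ≤ s := mul_le_of_le_one_right hs.le (pow_le_one₀ hq.le (by linarith))
    have hρq : s * q ^ (k + 1) = ρ * q := by rw [pow_succ, mul_assoc]
    have hρq2 : ρ * q ≤ ρ / 2 := by nlinarith
    rw [hρq] at hx hxp
    have hx0 : x 0 ∈ deepBox S a b ρ := mem_deepBox_of_dist_le hp (hx.mem 0) (by linarith)
    obtain ⟨j, hj, z, hz, hzx⟩ := hx.exists_enlarge hi (hS i hi) hc hρ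
      (by linarith [(hx0.2 i hi).2])
      fun l hl => room_of_mem_deepBox hε hρ.le hx0 l (mem_of_mem_erase hl)
    exact ih hj hz (by linarith [dist_triangle (z 0) (x 0) p])

theorem exists_isDescent_or_exists_isDescent_scale_mul_pow
    (hS : HasDescents c q ε (S.erase (c p))) (hc : Set.MapsTo c (Set.Icc a b) S) (hε : ε ≤ 1)
    (hq : 0 < q) (hq2 : q ≤ 1 / 2) (hs : 0 < s) (hsη : 2 * s ≤ η) (hp : p ∈ deepBox S a b η) :
    (∃ x, IsDescent c (Set.Icc a b) (c p) s q x ∧ x 0 = p) ∨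
      ∃ k, ∃ j ∈ S.erase (c p), ∃ z, IsDescent c (Set.Icc a b) j (s * q ^ k) q z ∧
        dist (z 0) p ≤ 2 * s := by
  set i := c p
  -- as `q ≤ 1 / 2`, the first `k` steps add up to at most `2 * s - 2 * (s * q ^ k)`
  let P (k : ℕ) (x : ι → ℝ) : Prop :=
    (x ∈ Set.Icc a b ∧ c x = i) ∧ dist x p ≤ 2 * s - 2 * (s * q ^ k)
  let R (k : ℕ) (x y : ι → ℝ) : Prop := y i = x i - s * q ^ k ∧ dist x y ≤ s * q ^ k
  by_cases hstep : ∀ k x, P k x → ∃ y, P (k + 1) y ∧ R k x y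
  · have hP₀ : P 0 p := ⟨⟨hp.1, rfl⟩, by simp⟩
    obtain ⟨x, hx₀, hx⟩ := exists_seq_of_forall_exists_succ hP₀ hstep
    exact .inl ⟨x, ⟨fun k => (hx k).1.1.1, fun k => (hx k).1.1.2, fun k => (hx k).2.1,
      fun k => (hx k).2.2⟩, hx₀⟩
  · push Not at hstep
    obtain ⟨k, x, ⟨⟨hxB, -⟩, hxp⟩, hstuck⟩ := hstep
    set ρ := s * q ^ k
    have hρ : 0 < ρ := by positivity
    have hρq : s * q ^ (k + 1) ≤ ρ / 2 := by
      rw [pow_succ, ← mul_assoc]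
      nlinarith
    have hx : x ∈ deepBox S a b ρ := mem_deepBox_of_dist_le hp hxB (by linarith)
    have hiS : i ∈ S := hc hp.1
    have hxi := hx.2 i hiS
    rcases exists_color_eq_or_exists_isDescent (t := x i - ρ) hS hc hρ hxB
      ⟨by linarith [hxi.1], by linarith [hxi.2]⟩ (by simp [abs_of_pos hρ])
      (fun l hl => room_of_mem_deepBox hε hρ.le hx l (mem_of_mem_erase hl))
      with ⟨y, hyB, hyx, hyi, hcy⟩ | ⟨j, hj, z, hz, hzx⟩
    · have hPy : P (k + 1) y := ⟨⟨hyB, hcy⟩, by linarith [dist_triangle y x p]⟩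
      exact absurd ⟨hyi, dist_comm y x ▸ hyx⟩ (hstuck y hPy)
    · exact .inr ⟨k, j, hj, z, hz, by linarith [dist_triangle (z 0) x p]⟩

theorem exists_isDescent_dist_le (hS : ∀ i ∈ S, HasDescents c q ε (S.erase i))
    (hc : Set.MapsTo c (Set.Icc a b) S) (hε : ε ≤ 1) (hq : 0 < q) (hq2 : q ≤ 1 / 2) (hs : 0 < s)
    (hsη : 2 * s ≤ η) (hsη' : 2 ≤ #S → 4 * s ≤ η) (hp : p ∈ deepBox S a b η) :
    ∃ i ∈ S, ∃ x, IsDescent c (Set.Icc a b) i s q x ∧ dist (x 0) p ≤ η := by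
  have hcp : c p ∈ S := hc hp.1
  rcases exists_isDescent_or_exists_isDescent_scale_mul_pow (hS _ hcp) hc hε hq hq2 hs hsη hp with
    ⟨x, hx, hxp⟩ | ⟨k, j, hj, z, hz, hzp⟩
  · exact ⟨c p, hcp, x, hx, by rw [hxp, dist_self]; linarith⟩
  · have hjS := mem_of_mem_erase hj
    have hcard : 2 ≤ #S := one_lt_card.2 ⟨j, hjS, c p, hcp, ne_of_mem_erase hj⟩
    have hscale : 0 < s * q ^ k := by positivity
    exact hz.exists_of_scale_mul_pow hS hc hε hq hq2 hs (hsη' hcard) hp hjS (by linarith)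

theorem HasDescents.of_erase (hS : ∀ i ∈ S, HasDescents c q ε (S.erase i)) (hε₀ : 0 < ε)
    (hε : ε ≤ 1 / 2) (hq : 0 < q) (hqε : q ≤ ε / 4) (hqε' : 2 ≤ #S → q ≤ ε / 8) :
    HasDescents c q (2 * ε) S := by
  intro a b r hr hab hside hc
  have hεr : 0 < ε * r := by positivity
  -- any descent starting within `ε * r / 2` of `p` leaves exactly enough room for a step up by `r`
  let p : ι → ℝ := fun l => if l ∈ S then a l + 3 / 2 * (ε * r) else a l
  have hpS : ∀ l ∈ S, p l = a l + 3 / 2 * (ε * r) := fun l hl => if_pos hl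
  have hpB : p ∈ Set.Icc a b := by
    refine ⟨fun l => ?_, fun l => ?_⟩ <;> by_cases hl : l ∈ S <;>
      simp only [p, hl, if_true, if_false]
    exacts [by linarith, le_rfl, by linarith [hside l hl], hab l]
  have hp : p ∈ deepBox S a b (ε * r / 2) := by
    refine ⟨hpB, fun l hl => ?_⟩
    rw [hpS l hl]
    constructor <;> linarith [hside l hl]
  obtain ⟨i, hi, x, hx, hxp⟩ := exists_isDescent_dist_le (s := r * q) hS hc (by linarith) hq
    (by linarith) (by positivity) (by nlinarith) (fun h => by nlinarith [hqε' h]) hp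
  have hx₀ : ∀ l ∈ S, a l + ε * r ≤ x 0 l ∧ x 0 l ≤ a l + 2 * (ε * r) := fun l hl => by
    have hxl := abs_le.1 ((dist_le_pi_dist (x 0) p l).trans hxp)
    rw [hpS l hl] at hxl
    constructor <;> linarith [hxl.1, hxl.2]
  obtain ⟨j, hj, z, hz, -⟩ := hx.exists_enlarge hi (hS i hi) hc hr
    (by linarith [(hx₀ i hi).2, hside i hi]) fun l hl => by
      obtain ⟨hal, hla⟩ := hx₀ l (mem_of_mem_erase hl)
      rw [max_eq_left (by nlinarith)]
      refine le_sub_iff_add_le.2 (le_min ?_ ?_) <;>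
        linarith [hside l (mem_of_mem_erase hl)]
  exact ⟨j, hj, z, hz⟩

end Descent

theorem hasDescents {ι : Type*} [Fintype ι] (c : (ι → ℝ) → ι) (S : Finset ι) {ε q : ℝ}
    (hε₀ : 0 < ε) (hε : ε ≤ 1 / 2) (hq : 0 < q) (hqε : q ≤ ε / 2 ^ (#S + 1)) :
    HasDescents c q (2 * ε) S := by
  classical
  induction hN : #S generalizing S ε with
  | zero =>
    intro a b r _ hab _ hc
    exact absurd (hc (Set.left_mem_Icc.2 hab)) (by simp [card_eq_zero.1 hN])
  | succ N ih =>
    rw [hN] at hqε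
    have hq_le : ∀ m ≤ N + 2, q ≤ ε / 2 ^ m := fun m hm =>
      hqε.trans (div_le_div_of_nonneg_left hε₀.le (by positivity)
        (pow_le_pow_right₀ one_le_two hm))
    refine .of_erase (fun i hi => ?_) hε₀ hε hq ((hq_le 2 (by omega)).trans_eq (by norm_num))
      fun hcard => (hq_le 3 (by omega)).trans_eq (by norm_num)
    have hcard : #(S.erase i) = N := by rw [card_erase_of_mem hi, hN, Nat.add_sub_cancel]
    have hqε' : q ≤ ε / 2 / 2 ^ (#(S.erase i) + 1) := by
      rwa [hcard, div_div, ← pow_succ']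
    simpa only [mul_div_cancel₀ ε two_ne_zero] using
      ih (S.erase i) (by linarith) (by linarith) hqε' hcard

section GeometricProgression

/-- The points of the geometric progression `geomBaton q` in increasing order. -/
noncomputable def geomPoint (q : ℝ) (k : ℕ) : ℝ := ∑ i ∈ range k, q ^ i

theorem geomBaton_eq_range (q : ℝ) : geomBaton q = Set.range (geomPoint q) := rfl

theorem geomPoint_succ (q : ℝ) (k : ℕ) : geomPoint q (k + 1) = geomPoint q k + q ^ k :=
  sum_range_succ _ _

theorem geomPoint_strictMono {q : ℝ} (hq : 0 < q) : StrictMono (geomPoint q) :=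
  strictMono_nat_of_lt_succ fun k => by
    rw [geomPoint_succ]
    exact lt_add_of_pos_right _ (pow_pos hq k)

theorem isCopy_range {α X Y : Type*} [MetricSpace X] [MetricSpace Y] {f : α → Y} {g : α → X}
    (h : ∀ u v, dist (g u) (g v) = dist (f u) (f v)) : IsCopy (Set.range f) (Set.range g) := by
  let φ (y : Set.range f) : X := g (Set.rangeSplitting f y)
  have hφ : Isometry φ := Isometry.of_dist_eq fun y z => by
    rw [h, Set.apply_rangeSplitting f, Set.apply_rangeSplitting f, Subtype.dist_eq]
  have hrange : Set.range φ = Set.range g := by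
    refine (Set.range_comp_subset_range _ g).antisymm ?_
    rintro _ ⟨u, rfl⟩
    let y : Set.range f := ⟨f u, u, rfl⟩
    have hyu : dist (φ y) (g u) = 0 := by rw [h, Set.apply_rangeSplitting f, dist_self]
    exact ⟨y, dist_eq_zero.1 hyu⟩
  exact hrange ▸ ⟨hφ.isometryEquivOnRange⟩

section

variable {ι : Type*} [Fintype ι] {c : (ι → ℝ) → ι} {B : Set (ι → ℝ)} {i : ι} {q r : ℝ}
  {x : ℕ → ι → ℝ}

theorem IsDescent.apply_eq (hx : IsDescent c B i r q x) (k : ℕ) :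
    x k i = x 0 i - r * geomPoint q k := by
  induction k with
  | zero => simp [geomPoint]
  | succ k ih =>
    rw [hx.apply_succ, ih, geomPoint_succ]
    ring

theorem IsDescent.dist_eq (hx : IsDescent c B i r q x) (j k : ℕ) :
    dist (x j) (x k) = dist (r * geomPoint q j) (r * geomPoint q k) := by
  wlog hjk : j ≤ k generalizing j k
  · rw [dist_comm, this k j (le_of_not_ge hjk), dist_comm]
  apply le_antisymm
  · calc dist (x j) (x k) ≤ ∑ l ∈ Ico j k, r * q ^ l :=
          dist_le_Ico_sum_of_dist_le hjk fun _ _ => hx.dist_succ_le _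
      _ = r * geomPoint q k - r * geomPoint q j := by
          rw [← mul_sum, sum_Ico_eq_sub _ hjk, mul_sub, geomPoint, geomPoint]
      _ ≤ dist (r * geomPoint q j) (r * geomPoint q k) := by
          rw [dist_comm]
          exact le_abs_self _
  · calc dist (r * geomPoint q j) (r * geomPoint q k) = dist (x j i) (x k i) := by
          rw [hx.apply_eq j, hx.apply_eq k, dist_sub_left]
      _ ≤ dist (x j) (x k) := dist_le_pi_dist _ _ i

end

theorem IsDescent.isProperCopy {n : ℕ} {c : (Fin n → ℝ) → Fin n} {B : Set (Fin n → ℝ)} {i : Fin n}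
    {q : ℝ} {x : ℕ → Fin n → ℝ} (hx : IsDescent c B i 1 q x) : IsProperCopy q (Set.range x) := by
  have happly : (fun y : Fin n → ℝ => y i) ∘ x = (fun g => x 0 i - g) ∘ geomPoint q :=
    funext fun k => by simpa only [one_mul, Function.comp_apply] using hx.apply_eq k
  rw [IsProperCopy, geomBaton_eq_range]
  refine ⟨isCopy_range fun j k => by simpa only [one_mul] using hx.dist_eq j k, i, x 0 i, ?_⟩
  rw [← Set.range_comp, ← Set.range_comp, happly]

theorem cube_eq_Icc (n : ℕ) (ε : ℝ) : cube n ε = Set.Icc (fun _ => -ε) (fun _ => 1 + ε) := by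
  ext x
  exact forall_and

theorem exists_isMonochromatic_isProperCopy {n : ℕ} {ε q : ℝ} (hε₀ : 0 < ε) (hε : ε ≤ 1 / 2)
    (hq : 0 < q) (hqε : q ≤ ε / 2 ^ (n + 1)) (c : cube n ε → Fin n) :
    ∃ C : Set (cube n ε),
      IsMonochromatic c C ∧ IsProperCopy q ((fun x : cube n ε => (x : Fin n → ℝ)) '' C) := by
  have hzero : (fun _ => 0) ∈ cube n ε := fun _ => ⟨by linarith, by linarith⟩
  let c' : (Fin n → ℝ) → Fin n := Function.extend Subtype.val c fun _ => c ⟨_, hzero⟩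
  obtain ⟨i, -, x, hx⟩ := hasDescents c' univ hε₀ hε hq (by simpa using hqε) one_pos
    (fun _ => by linarith : (fun _ => -ε) ≤ fun _ => 1 + ε) (fun _ _ => by linarith)
    fun _ _ => mem_coe.2 (mem_univ _)
  rw [← cube_eq_Icc] at hx
  have hcx : ∀ k, c ⟨x k, hx.mem k⟩ = i := fun k =>
    (Subtype.val_injective.extend_apply c _ _).symm.trans (hx.color_eq k)
  refine ⟨Set.range fun k => ⟨x k, hx.mem k⟩, ?_, ?_⟩
  · rintro _ ⟨j, rfl⟩ _ ⟨k, rfl⟩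
    rw [hcx, hcx]
  · rw [← Set.range_comp]
    exact hx.isProperCopy

end GeometricProgression

section Coloring

theorem IsMonochromatic.of_comp {X κ κ' : Type*} {c : X → κ} {f : κ → κ'}
    (hf : Function.Injective f) {C : Set X} (hC : IsMonochromatic (f ∘ c) C) :
    IsMonochromatic c C :=
  fun x hx y hy => hf (hC x hx y hy)

variable {X Y : Type*} [MetricSpace X] [MetricSpace Y]

theorem ColorableAvoiding.of_card_le {κ : Type*} [Fintype κ] {k : ℕ} (hk : Fintype.card κ ≤ k)
    (c : X → κ) (hc : ∀ C : Set X, IsCopy Y C → ¬ IsMonochromatic c C) :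
    ColorableAvoiding X Y k := by
  obtain ⟨f⟩ : Nonempty (κ ↪ Fin k) := Function.Embedding.nonempty_of_card_le (by simpa using hk)
  exact ⟨f ∘ c, fun C hC hmono => hc C hC (hmono.of_comp f.injective)⟩

theorem ColorableAvoiding.mono {k l : ℕ} (hkl : k ≤ l) (h : ColorableAvoiding X Y k) :
    ColorableAvoiding X Y l := by
  obtain ⟨c, hc⟩ := h
  exact .of_card_le (by simpa using hkl) c hc

theorem chromaticNumberAvoiding_eq_add_one {k : ℕ} (h : ColorableAvoiding X Y (k + 1))
    (hk : ¬ ColorableAvoiding X Y k) : chromaticNumberAvoiding X Y = k + 1 := by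
  refine le_antisymm (iInf₂_le (k + 1) h) (le_iInf₂ fun l hl => ?_)
  have hkl : k + 1 ≤ l := not_le.1 fun hlk => hk (hl.mono hlk)
  exact_mod_cast hkl

theorem not_colorableAvoiding {n : ℕ} {q : ℝ} (hq : 0 < q) (hqn : q ≤ 1 / 2 / 2 ^ (n + 1)) :
    ¬ ColorableAvoiding (Fin n → ℝ) (geomBaton q) n := by
  rintro ⟨c, hc⟩
  obtain ⟨C, hC, hcopy, -⟩ :=
    exists_isMonochromatic_isProperCopy one_half_pos le_rfl hq hqn (c ∘ Subtype.val)
  refine hc _ hcopy ?_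
  rintro _ ⟨x, hx, rfl⟩ _ ⟨y, hy, rfl⟩
  exact hC x hx y hy

end Coloring

section ResidueColoring

theorem exists_apply_eq_add_of_dist_eq {ι : Type*} [Fintype ι] {g : ℕ → ℝ} (hg : Monotone g)
    {x : ℕ → ι → ℝ} (hx : ∀ j k, dist (x j) (x k) = dist (g j) (g k)) {K : ℕ} (hK : g 0 < g K) :
    ∃ i, ∃ σ : ℝ, (σ = 1 ∨ σ = -1) ∧ ∀ k ≤ K, x k i = x 0 i + σ * (g k - g 0) := by
  have hdist : ∀ {j k}, j ≤ k → ∀ i, |x k i - x j i| ≤ g k - g j := fun {j k} hjk i => by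
    rw [← abs_of_nonneg (sub_nonneg.2 (hg hjk)), ← Real.dist_eq, ← Real.dist_eq, ← hx]
    exact dist_le_pi_dist _ _ i
  obtain ⟨i, hi⟩ : ∃ i, g K - g 0 ≤ |x K i - x 0 i| := by
    by_contra! h
    have hlt : dist (x K) (x 0) < g K - g 0 := (dist_pi_lt_iff (sub_pos.2 hK)).2 h
    rw [hx, Real.dist_eq, abs_of_pos (sub_pos.2 hK)] at hlt
    exact hlt.false
  rcases le_abs.1 hi with h | h
  · refine ⟨i, 1, .inl rfl, fun k hk => ?_⟩
    linarith [le_of_abs_le (hdist k.zero_le i), le_of_abs_le (hdist hk i)]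
  · refine ⟨i, -1, .inr rfl, fun k hk => ?_⟩
    linarith [neg_le_of_abs_le (hdist k.zero_le i), neg_le_of_abs_le (hdist hk i)]

theorem exists_forall_mul_pow_sub_mem_Icc {M q : ℝ} (hM : 1 ≤ M) (hq : 0 < q)
    (hqM : q ≤ 1 / (8 * M)) (K : ℕ) :
    ∃ u : ℝ, ∀ β ∈ Set.Icc u (u + 1 / 4), ∀ k < K,
      ∃ z : ℤ, β * q ^ k - M * z ∈ Set.Icc (1 / 4 : ℝ) (1 / 2) := by
  induction K with
  | zero => exact ⟨0, by simp⟩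
  | succ K ih =>
    obtain ⟨u, hu⟩ := ih
    have hM₀ : 0 < M := by linarith
    have hqM₈ : q * (8 * M) ≤ 1 := (le_div_iff₀ (by positivity)).1 hqM
    -- multiplication by `q` maps the new interval `M * z + [1 / 4, 1 / 2]` into the old one
    set z : ℤ := ⌈u / (q * M)⌉
    have hzu : u ≤ z * (q * M) := (div_le_iff₀ (by positivity)).1 (Int.le_ceil _)
    have huz : (z - 1) * (q * M) < u :=
      (lt_div_iff₀ (by positivity)).1 (sub_lt_iff_lt_add.2 (Int.ceil_lt_add_one _))
    refine ⟨M * z + 1 / 4, fun β ⟨hβ, hβ'⟩ k hk => ?_⟩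
    rcases k with _ | k
    · exact ⟨z, by constructor <;> linarith⟩
    · have hβq : β * q ∈ Set.Icc u (u + 1 / 4) := by constructor <;> nlinarith
      rw [pow_succ', ← mul_assoc]
      exact hu (β * q) hβq k (by omega)

theorem exists_le_apply_mem_Ico {δ η T : ℝ} {V : ℕ → ℝ} {K : ℕ}
    (hV : ∀ k < K, V (k + 1) - V k ∈ Set.Icc δ η) (h₀ : V 0 < T) (hK : T ≤ V 0 + K * δ) :
    ∃ k ≤ K, V k ∈ Set.Ico T (T + η) := by
  have hlow : ∀ k ≤ K, V 0 + k * δ ≤ V k := by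
    intro k hk
    induction k with
    | zero => simp
    | succ k ih =>
      push_cast
      linarith [ih (by omega), (hV k hk).1]
  have hex : ∃ k, T ≤ V k := ⟨K, hK.trans (hlow K le_rfl)⟩
  classical
  have hle : Nat.find hex ≤ K := Nat.find_min' hex (hK.trans (hlow K le_rfl))
  refine ⟨Nat.find hex, hle, Nat.find_spec hex, ?_⟩
  obtain ⟨k, hk⟩ : ∃ k, Nat.find hex = k + 1 :=
    Nat.exists_eq_succ_of_ne_zero fun h => h₀.not_ge ((Nat.find_eq_zero hex).1 h)
  have hkT : V k < T := not_le.1 (Nat.find_min hex (by omega))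
  rw [hk]
  linarith [(hV k (by omega)).2]

theorem exists_forall_exists_abs_mul_geomPoint_sub_lt {M q : ℝ} {K : ℕ} (hM : 1 ≤ M) (hq : 0 < q)
    (hqM : q ≤ 1 / (8 * M)) (hK : 4 * M ≤ K) :
    ∃ β : ℝ, ∀ τ : ℝ, ∃ k ≤ K, ∃ z : ℤ, |β * geomPoint q k - M * z - τ| < 1 / 2 := by
  have hM₀ : 0 < M := by linarith
  obtain ⟨β, hβ⟩ := exists_forall_mul_pow_sub_mem_Icc hM hq hqM K
  specialize hβ β ⟨le_rfl, by linarith⟩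
  choose! w hw using hβ
  let V (k : ℕ) : ℝ := β * geomPoint q k - M * (∑ i ∈ range k, w i : ℤ)
  have hV : ∀ k < K, V (k + 1) - V k ∈ Set.Icc (1 / 4 : ℝ) (1 / 2) := fun k hk => by
    convert hw k hk using 1
    simp only [V, geomPoint_succ, sum_range_succ, Int.cast_add]
    ring
  have hV₀ : V 0 = 0 := by simp [V, geomPoint]
  refine ⟨β, fun τ => ?_⟩
  have hT := toIocMod_mem_Ioc hM₀ 0 τ
  obtain ⟨k, hk, hTV, hVT⟩ := exists_le_apply_mem_Ico hV (T := toIocMod hM₀ 0 τ)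
    (by rw [hV₀]; exact hT.1) (by linarith [hT.2])
  refine ⟨k, hk, (∑ i ∈ range k, w i) - toIocDiv hM₀ 0 τ, ?_⟩
  have hsub : β * geomPoint q k - M * ((∑ i ∈ range k, w i) - toIocDiv hM₀ 0 τ : ℤ) - τ =
      V k - toIocMod hM₀ 0 τ := by
    rw [← self_sub_toIocDiv_zsmul, zsmul_eq_mul]
    push_cast [V]
    ring
  rw [hsub, abs_of_nonneg (sub_nonneg.2 hTV)]
  linarith

theorem exists_forall_exists_floor_eq {m : ℕ} (hm : 0 < m) {q : ℝ} (hq : 0 < q)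
    (hqm : q ≤ 1 / (8 * m)) :
    ∃ β : ℝ, ∀ t σ : ℝ, σ = 1 ∨ σ = -1 → ∀ j : ZMod m, ∃ k ≤ 4 * m,
      (⌊β * (t + σ * geomPoint q k)⌋ : ZMod m) = j := by
  obtain ⟨β, hβ⟩ := exists_forall_exists_abs_mul_geomPoint_sub_lt (K := 4 * m)
    (by exact_mod_cast hm) hq hqm (by push_cast; rfl)
  refine ⟨β, fun t σ hσ j => ?_⟩
  obtain ⟨d, rfl⟩ := ZMod.intCast_surjective j
  obtain ⟨k, hk, z, hz⟩ := hβ (σ * (d + 1 / 2 - β * t))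
  refine ⟨k, hk, ?_⟩
  obtain ⟨w, hw⟩ : ∃ w : ℤ, |β * (t + σ * geomPoint q k) - (m * w + d + 1 / 2)| < 1 / 2 := by
    rcases hσ with rfl | rfl
    · refine ⟨z, ?_⟩
      convert hz using 2
      ring
    · refine ⟨-z, ?_⟩
      rw [← abs_neg] at hz
      convert hz using 2
      push_cast
      ring
  have hfloor : ⌊β * (t + σ * geomPoint q k)⌋ = m * w + d := by
    rw [Int.floor_eq_iff]
    push_cast
    constructor <;> linarith [abs_lt.1 hw]
  simp [hfloor]

theorem colorableAvoiding_succ {n : ℕ} {q : ℝ} (hq : 0 < q) (hqn : q ≤ 1 / (8 * (n + 1 : ℕ))) :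
    ColorableAvoiding (Fin n → ℝ) (geomBaton q) (n + 1) := by
  obtain ⟨β, hβ⟩ := exists_forall_exists_floor_eq n.succ_pos hq hqn
  have hmissed : ∀ x : Fin n → ℝ, ∃ j : ZMod (n + 1), ∀ i, (⌊β * x i⌋ : ZMod (n + 1)) ≠ j := by
    intro x
    by_contra! h
    simpa [ZMod.card] using Fintype.card_le_of_surjective (fun i => (⌊β * x i⌋ : ZMod (n + 1))) h
  choose c hc using hmissed
  refine .of_card_le (ZMod.card (n + 1)).le c fun C ⟨e⟩ hmono => ?_
  let x (k : ℕ) : Fin n → ℝ := e ⟨geomPoint q k, k, rfl⟩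
  have hxC : ∀ k, x k ∈ C := fun k => Subtype.coe_prop _
  have hg := geomPoint_strictMono hq
  obtain ⟨i, σ, hσ, hxi⟩ := exists_apply_eq_add_of_dist_eq (x := x) hg.monotone
    (fun j k => e.isometry.dist_eq ⟨geomPoint q j, j, rfl⟩ ⟨geomPoint q k, k, rfl⟩)
    (hg (by omega : 0 < 4 * (n + 1)))
  obtain ⟨k, hk, hfloor⟩ := hβ (x 0 i) σ hσ (c (x 0))
  refine hc (x k) i ?_
  rw [hmono _ (hxC k) _ (hxC 0), hxi k hk, ← hfloor]
  simp [geomPoint]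

end ResidueColoring

theorem theorem6 :
    (∀ (n : ℕ) (ε : ℝ), 0 < ε → ε ≤ 1 / 2 →
      ∀ q : ℝ, 0 < q → q ≤ ε / 2 ^ (n + 1) →
        ∀ c : cube n ε → Fin n,
          ∃ C : Set (cube n ε),
            IsMonochromatic c C ∧ IsProperCopy q ((fun x : cube n ε => (x : Fin n → ℝ)) '' C)) ∧
    (∀ n : ℕ, ∃ q₀ : ℝ, 0 < q₀ ∧ ∀ q : ℝ, 0 < q → q ≤ q₀ →
      chromaticNumberAvoiding (Fin n → ℝ) (geomBaton q) = (n : ℕ∞) + 1) := by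
  refine ⟨fun n ε hε₀ hε q hq hqε c => exists_isMonochromatic_isProperCopy hε₀ hε hq hqε c,
    fun n => ⟨min (1 / 2 / 2 ^ (n + 1)) (1 / (8 * (n + 1 : ℕ))), by positivity,
      fun q hq hqn => ?_⟩⟩
  exact chromaticNumberAvoiding_eq_add_one
    (colorableAvoiding_succ hq (hqn.trans (min_le_right _ _)))
    (not_colorableAvoiding hq (hqn.trans (min_le_left _ _)))
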